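/- Let $L$ be the class of continuous functions $\alpha:\mathbb{R}\to[0,\infty)$ for which there is $x_0\in\mathbb{R}$ such that $\alpha(x)=\alpha(x_0)$ for $x\le x_0$, $\alpha$ is non-decreasing on $[x_0,\infty)$, and $\alpha(x)\to+\infty$ as $x\to+\infty$. Write $\alpha\in L_1$ if $\alpha\in L$ and there are $R_0\in\mathbb{R}$ and $c>0$ with $\alpha(a+b)\le\alpha(a)+\alpha(b)+c$ for all $a,b\ge R_0$; $\beta\in L_2$ if $\beta\in L$ and $\beta(x+O(1))=(1+o(1))\beta(x)$ as $x\to+\infty$; $\gamma\in L_3$ if $\gamma\in L$ and there is $R_0\in\mathbb{R}$ with $\gamma(a+b)\le\gamma(a)+\gamma(b)$ for all $a,b\ge R_0$. Put $\alpha^{-1}(y)=\inf\{t:\alpha(t)\ge y\}$ for $y>\inf\alpha$ (the ordinary inverse if $\alpha$ is strictly increasing on $[x_0,\infty)$). Let $\log^{[p]}$ denote the $p$-th iterate of $\log$. Let $\alpha\in L_1$, $\beta\in L_2$, $\gamma\in L_3$ be such that, as $x\to+\infty$, $\alpha(\log^{[p]}x)=o(\beta(\log\gamma(x)))$ for every integer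 $p\ge2$, $\alpha(\log x)=o(\alpha(x))$, and $\alpha^{-1}(\kappa x)=o(\alpha^{-1}(x))$ for every $0<\kappa<1$. For a function $g$ analytic in the unit disc $\Delta=\{z\in\mathbb{C}:|z|<1\}$ let $M(r,g)=\max_{|z|=r}|g(z)|$ for $0\le r<1$, and define, in $[0,+\infty]$, $$\varrho_{(\alpha,\beta,\gamma),M}[g]=\limsup_{r\to1^-}\frac{\alpha\left(\log^{[2]}M(r,g)\right)}{\beta\left(\log\gamma\left(\frac1{1-r}\right)\right)},\qquad \varrho_{(\alpha(\log),\beta,\gamma),M}[g]=\limsup_{r\to1^-}\frac{\alpha\left(\log^{[3]}M(r,g)\right)}{\beta\left(\log\gamma\left(\frac1{1-r}\right)\right)},$$ where the logarithms applied to $M(r,g)$ are read as $\log^+$, with $\log^+x=\log x$ for $x\ge1$ and $\log^+x=0$ for $0\le x<1$. **Theorem.** Let $k\ge2$ and let $A_0,\dots,A_{k-1}$ be analytic functions in $\Delta$ such that $$\max\left\{\varrho_{(\alpha,\beta,\gamma),M}[A_j]:j=1,\dots,k-1\right\}<\varrho_{(\alpha,\beta,\gamma),M}[A_0].$$ Then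 every solution $f\not\equiv0$, analytic in $\Delta$, of $$f^{(k)}+A_{k-1}(z)f^{(k-1)}+\cdots+A_0(z)f=0$$ satisfies $$\varrho_{(\alpha(\log),\beta,\gamma),M}[f]=\varrho_{(\alpha,\beta,\gamma),M}[A_0].$$ -/

import Mathlib

open Filter Topology Asymptotics

namespace UnitDiscGrowth

/-- The class `L`: continuous non-negative functions on the real line which are constant on some
`(-∞, x₀]`, and increase to `+∞` on `[x₀, ∞)`. -/
structure ClassL (α : ℝ → ℝ) : Prop where
  continuous : Continuous α
  nonneg : ∀ x, 0 ≤ α x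
  increasing : ∃ x₀ : ℝ, (∀ x ≤ x₀, α x = α x₀) ∧ MonotoneOn α (Set.Ici x₀)
  tendsto : Tendsto α atTop atTop

/-- The class `L₁`. -/
structure ClassL1 (α : ℝ → ℝ) : Prop extends ClassL α where
  quasi_subadd : ∃ R₀ c : ℝ, 0 < c ∧ ∀ a b, R₀ ≤ a → R₀ ≤ b → α (a + b) ≤ α a + α b + c

/-- The class `L₂`: `β (x + O(1)) = (1 + o(1)) β x` as `x → +∞`. -/
structure ClassL2 (β : ℝ → ℝ) : Prop extends ClassL β where
  shift : ∀ h : ℝ → ℝ, h =O[atTop] (fun _ => (1 : ℝ)) → (fun x => β (x + h x)) ~[atTop] β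

/-- The class `L₃`. -/
structure ClassL3 (γ : ℝ → ℝ) : Prop extends ClassL γ where
  subadd : ∃ R₀ : ℝ, ∀ a b, R₀ ≤ a → R₀ ≤ b → γ (a + b) ≤ γ a + γ b

/-- The inverse `α⁻¹` of a function of the class `L`. If `α` is constant on `(-∞, x₀]` and strictly
increasing on `[x₀, ∞)`, this is the ordinary inverse at each `y > α x₀`; in general it is the
left-continuous generalized inverse there. (Only its behaviour as `y → +∞` is used.) -/
noncomputable def inverse (α : ℝ → ℝ) (y : ℝ) : ℝ := sInf {t : ℝ | y ≤ α t}

/-- The standing assumptions on the triple `(α, β, γ)`. -/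
structure Admissible (α β γ : ℝ → ℝ) : Prop where
  mem_L1 : ClassL1 α
  mem_L2 : ClassL2 β
  mem_L3 : ClassL3 γ
  iter_log : ∀ p : ℕ, 2 ≤ p →
    (fun x => α (Real.log^[p] x)) =o[atTop] (fun x => β (Real.log (γ x)))
  comp_log : (fun x => α (Real.log x)) =o[atTop] α
  inverse_mul : ∀ k : ℝ, 0 ≤ k → k < 1 →
    (fun x => inverse α (k * x)) =o[atTop] inverse α

/-- The open unit disc. -/
def unitDisc : Set ℂ := Metric.ball 0 1

/-- The maximum modulus `M(r, f) = max_{|z| = r} |f z|`. -/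
noncomputable def maxModulus (r : ℝ) (f : ℂ → ℂ) : ℝ :=
  sSup ((fun z => ‖f z‖) '' Metric.sphere (0 : ℂ) r)

/-- `limsup_{r → 1⁻} α (log^[p] M(r, f)) / β (log γ (1 / (1 - r)))`, as an extended real number.
The logarithms applied to `M(r, f)` are `log⁺ = max 0 log`, so that the iterates always make sense.
If `M(r, f) → ∞`, this changes nothing for `r` near `1`; if `M(r, f)` is bounded, the upper limit
is `0`. -/
noncomputable def growthOrder (p : ℕ) (α β γ : ℝ → ℝ) (f : ℂ → ℂ) : EReal :=
  limsup (fun r : ℝ =>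
    ((α (Real.posLog^[p] (maxModulus r f)) / β (Real.log (γ (1 / (1 - r)))) : ℝ) : EReal))
    (𝓝[<] (1 : ℝ))

/-- The `(α, β, γ)`-order `ϱ_{(α,β,γ),M}[f]` of a function `f` analytic in the unit disc. -/
noncomputable def orderM (α β γ : ℝ → ℝ) (f : ℂ → ℂ) : EReal := growthOrder 2 α β γ f

/-- The `(α(log), β, γ)`-order `ϱ_{(α(log),β,γ),M}[f]` of a function `f` analytic in the unit
disc. -/
noncomputable def logOrderM (α β γ : ℝ → ℝ) (f : ℂ → ℂ) : EReal := growthOrder 3 α β γ f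

/-- `f` is an (analytic) solution in the unit disc of
`f^(k) + A_{k-1} f^(k-1) + ⋯ + A_0 f = 0`. -/
def IsSolution (k : ℕ) (A : ℕ → ℂ → ℂ) (f : ℂ → ℂ) : Prop :=
  AnalyticOnNhd ℂ f unitDisc ∧
    ∀ z ∈ unitDisc, iteratedDeriv k f z + ∑ j ∈ Finset.range k, A j z * iteratedDeriv j f z = 0

end UnitDiscGrowth

/-!
The proof compares maximum moduli directly, and holds for all `r` close to `1`.

*Upper bound.* Grönwall's inequality along rays, applied to the vector of the derivatives
`f, f', …, f^(k-1)`, gives `log⁺ M(r, f) ≤ C + k max_j M(r, A j)` (`posLog_maxModulus_solution_le`),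
so that `log^[3] M(r, f)` exceeds `max_j log^[2] M(r, A j)` by at most a constant.

*Lower bound.* Let `r' = 1 - (1 - r) / 4`. Write `f = z ^ m F` with `F 0 ≠ 0`. The number of zeros
of `F` in a disc slightly larger than `|z| ≤ r` is at most `C (1 + log⁺ M(r', f)) / (1 - r)`, and
after division by the corresponding linear factors, the Borel–Carathéodory theorem bounds the
variation of the logarithm of the remaining zero-free function. A pigeonhole argument then provides
a circle `|z| = t` with `r < t < r'` such that `f` grows by a bounded factor only on the disc of
radius `s` around each point of the circle, where `1 / s` is bounded by a polynomial in
`log⁺ M(r', f)` and `1 / (1 - r)` (`exists_circle_slow_variation`). By Cauchy's estimates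
`|f^(j) / f| ≤ C s^(-j)` on this circle. Solving the equation for `A 0` and using the maximum
principle,
`log⁺ M(r, A 0) ≤ C (1 + max_{j ≥ 1} log⁺ M(r', A j) + log⁺ log⁺ M(r', f) + log⁺ (1 / (1 - r)))`
(`posLog_maxModulus_coeff_zero_le`).

Both estimates are carried to the orders by three properties of the scale: `α (x + O(1))` exceeds
`α x` by a bounded amount only; replacing `r` by `r'` changes the denominator
`β (log γ (1 / (1 - r)))` by a factor `1 + o(1)`; and `α (log log (1 / (1 - r)))` is negligible
compared with it. If `f` had smaller order than `A 0`, all the terms on the right of the last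
estimate would have smaller order than the left hand side.
-/

namespace UnitDiscGrowth
open Metric Set

/-! ### Zeros of a function in a disc -/

/-- A bound at the origin for the cofactor of a product of linear factors: on `|z| = R`, each factor
`z - a` may be replaced by its reflection `(R ^ 2 - ā z) / R`, which has the same modulus there and
the modulus `R` at the origin. -/
lemma norm_mul_pow_length_le {R M : ℝ} (hR : 0 < R) (l : List ℂ) (g : ℂ → ℂ)
    (hg : DiffContOnCl ℂ g (ball 0 R))
    (hM : ∀ z ∈ sphere (0 : ℂ) R, ‖(l.map (fun a => z - a)).prod * g z‖ ≤ M) :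
    ‖g 0‖ * R ^ l.length ≤ M := by
  induction l generalizing g with
  | nil =>
    simp only [List.length_nil, pow_zero, mul_one]
    refine Complex.norm_le_of_forall_mem_frontier_norm_le isBounded_ball hg ?_
      (subset_closure (mem_ball_self hR))
    intro z hz
    rw [frontier_ball _ hR.ne'] at hz
    simpa using hM z hz
  | cons a l ih =>
    have hb : Differentiable ℂ fun z : ℂ => ((R : ℂ) ^ 2 - (starRingEnd ℂ) a * z) / R := by
      fun_prop
    have := ih (fun z => ((R : ℂ) ^ 2 - (starRingEnd ℂ) a * z) / R * g z)
      (hb.diffContOnCl.smul hg) ?_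
    · have hRn : ‖(R : ℂ)‖ = R := by simp [abs_of_pos hR]
      rw [List.length_cons, pow_succ]
      have h0 : ‖((R : ℂ) ^ 2 - (starRingEnd ℂ) a * 0) / R * g 0‖ = R * ‖g 0‖ := by
        rw [mul_zero, sub_zero, norm_mul, norm_div, norm_pow, hRn, sq,
          mul_div_cancel_right₀ _ hR.ne']
      rw [h0] at this
      linarith
    · intro z hz
      have hzR : ‖z‖ = R := by simpa using hz
      have hzz : (R : ℂ) ^ 2 = z * (starRingEnd ℂ) z := by
        rw [Complex.mul_conj, Complex.normSq_eq_norm_sq, hzR]; push_cast; ring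
      have hnorm : ‖((R : ℂ) ^ 2 - (starRingEnd ℂ) a * z) / R‖ = ‖z - a‖ := by
        have : (R : ℂ) ^ 2 - (starRingEnd ℂ) a * z = z * (starRingEnd ℂ) (z - a) := by
          rw [hzz, map_sub]; ring
        rw [this, norm_div, norm_mul, RCLike.norm_conj, hzR]
        simp [abs_of_pos hR, hR.ne']
      have := hM z hz
      simp only [List.map_cons, List.prod_cons, norm_mul] at this ⊢
      rw [hnorm]
      linarith

lemma norm_prod_sub_le {c : ℝ} (l : List ℂ) (z : ℂ) (h : ∀ a ∈ l, ‖z - a‖ ≤ c) :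
    ‖(l.map (fun a => z - a)).prod‖ ≤ c ^ l.length := by
  induction l with
  | nil => simp
  | cons a l ih =>
    simp only [List.map_cons, List.prod_cons, norm_mul, List.length_cons, pow_succ']
    have h1 := h a (by simp)
    have h2 := ih (fun b hb => h b (by simp [hb]))
    have h3 := (norm_nonneg _).trans h1
    gcongr

lemma pow_length_le_norm_prod_sub {c : ℝ} (hc : 0 ≤ c) (l : List ℂ) (z : ℂ)
    (h : ∀ a ∈ l, c ≤ ‖z - a‖) : c ^ l.length ≤ ‖(l.map (fun a => z - a)).prod‖ := by
  induction l with
  | nil => simp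
  | cons a l ih =>
    simp only [List.map_cons, List.prod_cons, norm_mul, List.length_cons, pow_succ']
    have h1 := h a (by simp)
    have h2 := ih (fun b hb => h b (by simp [hb]))
    gcongr

/-- A bound of Jensen type for the number of zeros of `F` in `|z| ≤ R`, counted with
multiplicity: it grows at most like `log (M / ‖F 0‖) / log (R₂ / R)`. -/
lemma pow_length_le_of_factorization {F g : ℂ → ℂ} {R R₂ M : ℝ} (hR : 0 < R) (hR₂ : R < R₂)
    (l : List ℂ) (hl : ∀ a ∈ l, ‖a‖ ≤ R) (hg : DiffContOnCl ℂ g (ball 0 R₂))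
    (hFg : ∀ z ∈ closedBall (0 : ℂ) R₂, F z = (l.map (fun a => z - a)).prod * g z)
    (hM : ∀ z ∈ sphere (0 : ℂ) R₂, ‖F z‖ ≤ M) :
    ‖F 0‖ * (R₂ / R) ^ l.length ≤ M := by
  have hR₂0 : 0 < R₂ := hR.trans hR₂
  have h1 := norm_mul_pow_length_le hR₂0 l g hg fun z hz => by
    rw [← hFg z (sphere_subset_closedBall hz)]; exact hM z hz
  have h2 : ‖F 0‖ ≤ R ^ l.length * ‖g 0‖ := by
    rw [hFg 0 (by simp [hR₂0.le]), norm_mul]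
    gcongr
    exact norm_prod_sub_le l 0 (by simpa using hl)
  calc ‖F 0‖ * (R₂ / R) ^ l.length ≤ R ^ l.length * ‖g 0‖ * (R₂ / R) ^ l.length := by gcongr
    _ = ‖g 0‖ * R₂ ^ l.length := by rw [div_pow]; field_simp
    _ ≤ M := h1

/-- The zeros in a closed disc can be split off as finitely many linear factors. -/
lemma exists_factorization {F : ℂ → ℂ} {R R₂ ρ : ℝ} (hR : 0 < R) (hR₂ : R < R₂) (hρ : R₂ < ρ)
    (hF : DifferentiableOn ℂ F (ball 0 ρ)) (hF0 : F 0 ≠ 0) :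
    ∃ (l : List ℂ) (g : ℂ → ℂ), (∀ a ∈ l, ‖a‖ ≤ R) ∧ DifferentiableOn ℂ g (ball 0 ρ) ∧
      (∀ z ∈ ball (0 : ℂ) ρ, F z = (l.map (fun a => z - a)).prod * g z) ∧
      ∀ z ∈ closedBall (0 : ℂ) R, g z ≠ 0 := by
  set S : Set ℕ := {n | ∃ (l : List ℂ) (g : ℂ → ℂ), l.length = n ∧ (∀ a ∈ l, ‖a‖ ≤ R) ∧
    DifferentiableOn ℂ g (ball 0 ρ) ∧
    ∀ z ∈ ball (0 : ℂ) ρ, F z = (l.map (fun a => z - a)).prod * g z} with hS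
  have hcl : closedBall (0 : ℂ) R₂ ⊆ ball 0 ρ := closedBall_subset_ball hρ
  have hdc : ∀ g : ℂ → ℂ, DifferentiableOn ℂ g (ball 0 ρ) → DiffContOnCl ℂ g (ball 0 R₂) :=
    fun g hg => DifferentiableOn.diffContOnCl
      (hg.mono (closure_ball_subset_closedBall.trans hcl))
  obtain ⟨M, hM⟩ : ∃ M, ∀ z ∈ sphere (0 : ℂ) R₂, ‖F z‖ ≤ M :=
    (isCompact_sphere _ _).exists_bound_of_continuousOn
      (hF.continuousOn.mono (sphere_subset_closedBall.trans hcl))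
  have hne : S.Nonempty := ⟨0, [], F, by simp, by simp, hF, by simp⟩
  have hbdd : BddAbove S := by
    have h1 : 1 < R₂ / R := (one_lt_div hR).2 hR₂
    obtain ⟨n₀, hn₀⟩ := pow_unbounded_of_one_lt (M / ‖F 0‖) h1
    refine ⟨n₀, ?_⟩
    rintro n ⟨l, g, rfl, hl, hg, hFg⟩
    by_contra! hlt
    have h2 := pow_length_le_of_factorization hR hR₂ l hl (hdc g hg)
      (fun z hz => hFg z (hcl hz)) hM
    have h3 : (R₂ / R) ^ n₀ ≤ (R₂ / R) ^ l.length := pow_le_pow_right₀ h1.le hlt.le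
    rw [div_lt_iff₀ (norm_pos_iff.2 hF0)] at hn₀
    have := mul_le_mul_of_nonneg_left h3 (norm_nonneg (F 0))
    linarith
  -- A factorization with the largest possible number of factors has a zero-free cofactor.
  obtain ⟨l, g, hlen, hl, hg, hFg⟩ := Nat.sSup_mem hne hbdd
  refine ⟨l, g, hl, hg, hFg, fun a ha hga => ?_⟩
  have haρ : a ∈ ball (0 : ℂ) ρ := hcl (closedBall_subset_closedBall hR₂.le ha)
  have hmem : l.length + 1 ∈ S := by
    refine ⟨a :: l, dslope g a, by simp, ?_, ?_, fun z hz => ?_⟩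
    · rintro b hb
      rcases List.mem_cons.1 hb with rfl | hb
      · simpa using ha
      · exact hl b hb
    · exact (Complex.differentiableOn_dslope (isOpen_ball.mem_nhds haρ)).2 hg
    · have := sub_smul_dslope g a z
      rw [hga, sub_zero, smul_eq_mul] at this
      rw [hFg z hz, ← this, List.map_cons, List.prod_cons]
      ring
  have := le_csSup hbdd hmem
  omega

/-! ### Radii on which a function varies slowly -/

/-- A zero-free function on a disc has a holomorphic logarithm. -/
lemma exists_eq_mul_exp {g : ℂ → ℂ} {R : ℝ} (hR : 0 < R) (hg : DifferentiableOn ℂ g (ball 0 R))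
    (h0 : ∀ z ∈ ball (0 : ℂ) R, g z ≠ 0) :
    ∃ h : ℂ → ℂ, DifferentiableOn ℂ h (ball 0 R) ∧ h 0 = 0 ∧
      ∀ z ∈ ball (0 : ℂ) R, g z = g 0 * Complex.exp (h z) := by
  have hex : Complex.IsExactOn (fun z => deriv g z / g z) (ball 0 R) :=
    ((hg.deriv isOpen_ball).div hg h0).isExactOn_ball
  obtain ⟨h, hh0, hh⟩ := hex.with_val_at 0 0
  refine ⟨h, fun z hz => (hh z hz).differentiableAt.differentiableWithinAt, hh0, fun z hz => ?_⟩
  have hd : ∀ w ∈ ball (0 : ℂ) R, HasDerivAt (fun w => g w * Complex.exp (-h w)) 0 w := by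
    intro w hw
    have h1 := ((hg w hw).differentiableAt (isOpen_ball.mem_nhds hw)).hasDerivAt
    refine (h1.mul (hh w hw).neg.cexp).congr_deriv ?_
    have := h0 w hw
    simp only [Pi.neg_apply]
    field_simp
    ring
  have hconst := isOpen_ball.is_const_of_deriv_eq_zero (convex_ball (0 : ℂ) R).isPreconnected
    (fun w hw => (hd w hw).differentiableAt.differentiableWithinAt)
    (fun w hw => (hd w hw).deriv) hz (mem_ball_self hR)
  simp only [hh0, neg_zero, Complex.exp_zero, mul_one] at hconst
  rw [← hconst, mul_assoc, ← Complex.exp_add]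
  simp

/-- Some point of `(r, r + d)` keeps a distance of at least `d / (2 (n + 1))` from `n` given values:
by the pigeonhole principle, they cannot come closer than that to all `n + 1` points of an
arithmetic progression with difference `d / (n + 1)`. -/
lemma exists_radius_away {r d : ℝ} (hd : 0 < d) (l : List ℝ) :
    ∃ t, r < t ∧ t < r + d ∧ ∀ x ∈ l, d / (2 * (l.length + 1)) ≤ |t - x| := by
  set η : ℝ := d / (2 * (l.length + 1)) with hη
  have hη0 : 0 < η := by positivity
  have hdη : d = 2 * (l.length + 1) * η := by rw [hη]; field_simp
  let t : ℕ → ℝ := fun i => r + (2 * i + 1) * η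
  have key : ∃ i ∈ Finset.range (l.length + 1), ∀ x ∈ l, η ≤ |t i - x| := by
    by_contra! hcon
    choose! x hx using hcon
    obtain ⟨i, hi, j, hj, hij, hxij⟩ := Finset.exists_ne_map_eq_of_card_lt_of_maps_to
      (s := Finset.range (l.length + 1)) (t := l.toFinset) (f := x)
      (by simpa using Nat.lt_succ_of_le (List.toFinset_card_le l))
      (fun i hi => by simpa using (hx i (by simpa using hi)).1)
    have h1 := (hx i hi).2
    have h2 := (hx j hj).2
    rw [hxij] at h1
    have h3 : |t i - t j| < 2 * η := by
      calc |t i - t j| = |(t i - x j) - (t j - x j)| := by ring_nf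
        _ ≤ |t i - x j| + |t j - x j| := abs_sub _ _
        _ < 2 * η := by linarith
    have h4 : t i - t j = ((i : ℤ) - j : ℤ) * (2 * η) := by simp only [t]; push_cast; ring
    have h5 : (1 : ℝ) ≤ |(((i : ℤ) - j : ℤ) : ℝ)| := by
      rw [← Int.cast_abs]
      have : (1 : ℤ) ≤ |(i : ℤ) - j| := Int.one_le_abs (sub_ne_zero.2 (by exact_mod_cast hij))
      exact_mod_cast this
    rw [h4, abs_mul, abs_of_pos (by positivity : 0 < 2 * η)] at h3
    nlinarith
  obtain ⟨i, hi, hil⟩ := key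
  have hi' : (i : ℝ) ≤ l.length := by exact_mod_cast Nat.lt_succ_iff.1 (Finset.mem_range.1 hi)
  refine ⟨t i, ?_, ?_, hil⟩
  · simp only [t]; nlinarith [show (0 : ℝ) ≤ i from Nat.cast_nonneg i]
  · simp only [t]; rw [hdη]; nlinarith

lemma norm_prod_sub_le_exp_mul {η s : ℝ} (hη : 0 < η) (l : List ℂ) (z w : ℂ)
    (hz : ∀ a ∈ l, η ≤ ‖z - a‖) (hw : ‖w - z‖ ≤ s) :
    ‖(l.map (fun a => w - a)).prod‖ ≤
      Real.exp (l.length * (s / η)) * ‖(l.map (fun a => z - a)).prod‖ := by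
  induction l with
  | nil => simp
  | cons a l ih =>
    have h2 := ih (fun b hb => hz b (by simp [hb]))
    have h1 := hz a (by simp)
    have h3 : ‖w - a‖ ≤ Real.exp (s / η) * ‖z - a‖ := by
      have hs : s = s / η * η := by field_simp
      have hs0 : 0 ≤ s / η := div_nonneg ((norm_nonneg _).trans hw) hη.le
      calc ‖w - a‖ = ‖(w - z) + (z - a)‖ := by ring_nf
        _ ≤ ‖w - z‖ + ‖z - a‖ := norm_add_le _ _
        _ ≤ s / η * ‖z - a‖ + ‖z - a‖ := by
          gcongr
          refine hw.trans (hs.le.trans ?_)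
          gcongr
        _ = (s / η + 1) * ‖z - a‖ := by ring
        _ ≤ Real.exp (s / η) * ‖z - a‖ := by gcongr; exact Real.add_one_le_exp _
    simp only [List.map_cons, List.prod_cons, norm_mul, List.length_cons]
    calc ‖w - a‖ * ‖(l.map (fun a => w - a)).prod‖
        ≤ (Real.exp (s / η) * ‖z - a‖) *
          (Real.exp (l.length * (s / η)) * ‖(l.map (fun a => z - a)).prod‖) := by gcongr
      _ = (Real.exp (s / η) * Real.exp (l.length * (s / η))) *
          (‖z - a‖ * ‖(l.map (fun a => z - a)).prod‖) := by ring
      _ = _ := by rw [← Real.exp_add]; push_cast; ring_nf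

/-- There are circles on which `F` varies slowly: if `F 0 ≠ 0`, then close to every `r < 1` there is
a circle `|z| = t` such that `F` grows by a bounded factor only on the disc of radius
`d ^ 4 / (32 L ^ 2)` around each of its points. Here `L` dominates the number of zeros (times `d`),
and the logarithm of the zero-free factor has Lipschitz constant at most `32 L / d ^ 4`. -/
lemma exists_circle_slow_variation {F : ℂ → ℂ} {r d M L : ℝ}
    (hF : DifferentiableOn ℂ F (ball 0 1)) (hF0 : F 0 ≠ 0) (hr : 0 < r) (hd : 0 < d)
    (hrd : r + 4 * d = 1) (hM : ∀ z ∈ sphere (0 : ℂ) (r + 3 * d), ‖F z‖ ≤ M)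
    (hL1 : 1 ≤ L) (hL : Real.log M - Real.log ‖F 0‖ ≤ L) :
    ∃ t, r < t ∧ t < r + d ∧ ∀ z ∈ sphere (0 : ℂ) t, F z ≠ 0 ∧
      ∀ w, ‖w - z‖ ≤ d ^ 4 / (32 * L ^ 2) → ‖F w‖ ≤ Real.exp 2 * ‖F z‖ := by
  have hd4 : d ≤ 1 / 4 := by linarith
  have hL0 : 0 < L := by linarith
  set R := r + 2 * d with hRdef
  set R₂ := r + 3 * d with hR₂def
  have hR0 : 0 < R := by positivity
  have hRR : R < R₂ := by linarith
  have hR₂1 : R₂ < 1 := by linarith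
  have hR₂0 : 0 < R₂ := by positivity
  have hFpos : 0 < ‖F 0‖ := norm_pos_iff.2 hF0
  obtain ⟨l, g, hl, hg, hFg, hg0⟩ := exists_factorization hR0 hRR hR₂1 hF hF0
  have hcl : closedBall (0 : ℂ) R₂ ⊆ ball 0 1 := closedBall_subset_ball hR₂1
  have hgdc : DiffContOnCl ℂ g (ball 0 R₂) :=
    DifferentiableOn.diffContOnCl (hg.mono (closure_ball_subset_closedBall.trans hcl))
  have hcount := pow_length_le_of_factorization hR0 hRR l hl hgdc
    (fun z hz => hFg z (hcl hz)) hM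
  have hMpos : 0 < M := lt_of_lt_of_le (by positivity) hcount
  set N : ℝ := (l.length : ℝ) with hN
  have hN0 : 0 ≤ N := by positivity
  have hNd : N * d ≤ L := by
    have h1 := Real.log_le_log (by positivity) hcount
    rw [Real.log_mul hFpos.ne' (by positivity), Real.log_pow] at h1
    have h2 : d ≤ Real.log (R₂ / R) := by
      have h3 := Real.one_sub_inv_le_log_of_pos (show 0 < R₂ / R by positivity)
      have h4 : d ≤ 1 - (R₂ / R)⁻¹ := by
        rw [inv_div, one_sub_div hR₂0.ne', le_div_iff₀ hR₂0]
        nlinarith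
      linarith
    have := mul_le_mul_of_nonneg_left h2 hN0
    linarith
  -- the size of the zero-free factor
  have hg00 : g 0 ≠ 0 := hg0 0 (by simp [hR0.le])
  have hgpos : 0 < ‖g 0‖ := norm_pos_iff.2 hg00
  have hFg0 : ‖F 0‖ ≤ ‖g 0‖ := by
    rw [hFg 0 (by simp), norm_mul]
    have h1 : ‖(l.map (fun a => 0 - a)).prod‖ ≤ 1 ^ l.length :=
      norm_prod_sub_le l 0 (fun a ha => by simpa using (hl a ha).trans (by linarith))
    rw [one_pow] at h1
    nlinarith
  have hgM : ∀ z ∈ ball (0 : ℂ) R₂, ‖g z‖ ≤ M / d ^ l.length := by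
    intro z hz
    refine Complex.norm_le_of_forall_mem_frontier_norm_le isBounded_ball hgdc ?_
      (subset_closure hz)
    intro w hw
    rw [frontier_ball _ hR₂0.ne'] at hw
    have hwR : ‖w‖ = R₂ := by simpa using hw
    have h1 := hM w hw
    rw [hFg w (hcl (sphere_subset_closedBall hw)), norm_mul] at h1
    have h2 : d ^ l.length ≤ ‖(l.map (fun a => w - a)).prod‖ :=
      pow_length_le_norm_prod_sub hd.le l w (fun a ha => by
        have := norm_sub_norm_le w a
        have := hl a ha
        linarith)
    rw [le_div_iff₀ (by positivity)]
    calc ‖g w‖ * d ^ l.length ≤ ‖g w‖ * ‖(l.map (fun a => w - a)).prod‖ := by gcongr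
      _ ≤ M := by linarith
  obtain ⟨h, hh, hh0, hgh⟩ := exists_eq_mul_exp hR0
    (hg.mono (ball_subset_ball (by linarith)))
    (fun z hz => hg0 z (ball_subset_closedBall hz))
  have hlogd : - Real.log d ≤ 1 / d := by
    have := Real.log_le_sub_one_of_pos (show 0 < 1 / d by positivity)
    rw [one_div, Real.log_inv] at this
    rw [one_div]; linarith
  set B : ℝ := 2 * L / d ^ 2 with hB
  have hB0 : 0 < B := by positivity
  have hre : MapsTo h (ball 0 R) {z | z.re ≤ B} := by
    intro z hz
    have h1 := hgM z (ball_subset_ball hRR.le hz)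
    rw [hgh z hz, norm_mul, Complex.norm_exp] at h1
    have h2 := Real.log_le_log (by positivity) h1
    rw [Real.log_mul hgpos.ne' (by positivity), Real.log_exp,
      Real.log_div hMpos.ne' (by positivity), Real.log_pow] at h2
    have h3 := Real.log_le_log hFpos hFg0
    have h4 : N * (- Real.log d) ≤ L / d ^ 2 := by
      calc N * (- Real.log d) ≤ N * (1 / d) := by gcongr
        _ = N * d / d ^ 2 := by field_simp
        _ ≤ L / d ^ 2 := by gcongr
    have h5 : L ≤ L / d ^ 2 := by
      rw [le_div_iff₀ (by positivity)]
      nlinarith [pow_le_one₀ hd.le (by linarith : d ≤ 1) (n := 2)]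
    have h6 : B = L / d ^ 2 + L / d ^ 2 := by rw [hB]; ring
    change (h z).re ≤ B
    linarith
  have hhb : ∀ z ∈ ball (0 : ℂ) (r + 3 / 2 * d), ‖h z‖ ≤ 4 * B / d := by
    intro z hz
    have hz' : ‖z‖ < r + 3 / 2 * d := by simpa using hz
    have h1 := Complex.borelCaratheodory_zero hB0 hh hre hR0
      (ball_subset_ball (by linarith) hz) hh0
    refine h1.trans ?_
    have h2 : d / 2 ≤ R - ‖z‖ := by linarith
    calc 2 * B * ‖z‖ / (R - ‖z‖) ≤ 2 * B * 1 / (d / 2) := by gcongr; linarith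
      _ = 4 * B / d := by field_simp; norm_num
  -- the radius `t` keeps away from the moduli of all zeros
  obtain ⟨t, hrt, htd, haway⟩ := exists_radius_away (r := r) hd (l.map (fun a => ‖a‖))
  rw [List.length_map] at haway
  set η : ℝ := d / (2 * (N + 1)) with hη
  have hη0 : 0 < η := by positivity
  set s : ℝ := d ^ 4 / (32 * L ^ 2) with hs
  have hs0 : 0 < s := by positivity
  have hL2 : L ≤ L ^ 2 := by nlinarith
  have hsd : s < d / 2 := by
    rw [hs, div_lt_iff₀ (by positivity)]
    have : d ^ 4 ≤ d * 1 := by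
      rw [pow_succ']; gcongr; exact pow_le_one₀ hd.le (by linarith)
    nlinarith
  have hNs : N * (s / η) ≤ 1 := by
    have h1 : N * (s / η) = (N * d) * (N * d + d) * (d / (16 * L ^ 2)) := by
      rw [hs, hη]; field_simp; ring
    rw [h1]
    calc (N * d) * (N * d + d) * (d / (16 * L ^ 2))
        ≤ L * (L + 1) * (1 / (16 * L ^ 2)) := by gcongr <;> linarith
      _ ≤ L * (L + L) * (1 / (16 * L ^ 2)) := by gcongr
      _ ≤ 1 := by field_simp; norm_num
  refine ⟨t, hrt, htd, fun z hz => ?_⟩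
  have hzt : ‖z‖ = t := by simpa using hz
  have hzaway : ∀ a ∈ l, η ≤ ‖z - a‖ := by
    intro a ha
    have := haway ‖a‖ (List.mem_map.2 ⟨a, ha, rfl⟩)
    rw [← hzt] at this
    exact this.trans (abs_norm_sub_norm_le z a)
  have hz1 : z ∈ ball (0 : ℂ) 1 := by simp [hzt]; linarith
  have hzR : z ∈ ball (0 : ℂ) R := by simp [hzt]; linarith
  refine ⟨?_, fun w hw => ?_⟩
  · rw [hFg z hz1]
    have h1 := pow_length_le_norm_prod_sub hη0.le l z hzaway
    exact mul_ne_zero (norm_pos_iff.1 (lt_of_lt_of_le (by positivity) h1))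
      (hg0 z (ball_subset_closedBall hzR))
  · have hwt : ‖w‖ < r + 3 / 2 * d := by
      have := norm_add_le (w - z) z
      rw [sub_add_cancel] at this
      linarith
    have hw1 : w ∈ ball (0 : ℂ) 1 := by simp; linarith
    have hwR : w ∈ ball (0 : ℂ) R := by simp; linarith
    have hsub : ball z (d / 2) ⊆ ball (0 : ℂ) (r + 3 / 2 * d) :=
      ball_subset_ball' (by rw [dist_zero_right, hzt]; linarith)
    have hlip := Complex.dist_le_div_mul_dist_of_mapsTo_ball (f := h) (c := z) (z := w)
      (R₁ := d / 2) (R₂ := 8 * B / d)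
      (hh.mono (hsub.trans (ball_subset_ball (by linarith)))) (fun x hx => by
        rw [mem_closedBall, dist_eq_norm]
        have h1 := hhb x (hsub hx)
        have h2 := hhb z (hsub (mem_ball_self (by positivity)))
        calc ‖h x - h z‖ ≤ ‖h x‖ + ‖h z‖ := norm_sub_le _ _
          _ ≤ 4 * B / d + 4 * B / d := add_le_add h1 h2
          _ = 8 * B / d := by ring)
      (by rw [mem_ball, dist_eq_norm]; linarith)
    rw [dist_eq_norm, dist_eq_norm] at hlip
    have hlip1 : ‖h w - h z‖ ≤ 1 := by
      calc ‖h w - h z‖ ≤ 8 * B / d / (d / 2) * ‖w - z‖ := hlip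
        _ ≤ 8 * B / d / (d / 2) * s := by gcongr
        _ = 1 / L := by rw [hB, hs]; field_simp; norm_num
        _ ≤ 1 := by rw [div_le_one hL0]; exact hL1
    have hre1 : (h w).re ≤ 1 + (h z).re := by
      have := (Complex.re_le_norm (h w - h z)).trans hlip1
      rw [Complex.sub_re] at this
      linarith
    have hprod := norm_prod_sub_le_exp_mul hη0 l z w hzaway hw
    rw [hFg w hw1, hFg z hz1, hgh w hwR, hgh z hzR]
    simp only [norm_mul, Complex.norm_exp]
    calc ‖(l.map (fun a => w - a)).prod‖ * (‖g 0‖ * Real.exp (h w).re)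
        ≤ (Real.exp 1 * ‖(l.map (fun a => z - a)).prod‖) *
          (‖g 0‖ * Real.exp (1 + (h z).re)) := by
          gcongr
          refine hprod.trans ?_
          gcongr
      _ = _ := by
          rw [Real.exp_add, show (2 : ℝ) = 1 + 1 by norm_num, Real.exp_add]; ring

/-- An analytic function on the unit disc which is not identically zero is a power of `z` times a
function which does not vanish at the origin. -/
lemma exists_eq_pow_mul {f : ℂ → ℂ} (hf : AnalyticOnNhd ℂ f (ball 0 1))
    (hf0 : ∃ z ∈ ball (0 : ℂ) 1, f z ≠ 0) :
    ∃ (m : ℕ) (F : ℂ → ℂ), DifferentiableOn ℂ F (ball 0 1) ∧ F 0 ≠ 0 ∧ ∀ z, f z = z ^ m * F z := by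
  have h0 : (0 : ℂ) ∈ ball (0 : ℂ) 1 := by simp
  have hne : ¬ ∀ᶠ z in 𝓝 (0 : ℂ), f z = 0 := by
    intro h
    obtain ⟨z, hz, hfz⟩ := hf0
    exact hfz (hf.eqOn_zero_of_preconnected_of_eventuallyEq_zero
      (convex_ball (0 : ℂ) 1).isPreconnected h0 h hz)
  obtain ⟨m, g, hg, hg0, hfg⟩ := (hf 0 h0).exists_eventuallyEq_pow_smul_nonzero_iff.2 hne
  simp only [sub_zero, smul_eq_mul] at hfg
  have heq : ∀ z, f z = z ^ m * Function.update (fun z => f z / z ^ m) 0 (g 0) z := by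
    intro z
    rcases eq_or_ne z 0 with rfl | hz
    · simpa using hfg.self_of_nhds
    · rw [Function.update_of_ne hz]
      field_simp
  refine ⟨m, Function.update (fun z => f z / z ^ m) 0 (g 0), fun z hz => ?_, by simpa using hg0,
    heq⟩
  refine DifferentiableAt.differentiableWithinAt ?_
  rcases eq_or_ne z 0 with rfl | hz0
  · refine hg.differentiableAt.congr_of_eventuallyEq ?_
    filter_upwards [hfg] with w hw
    rcases eq_or_ne w 0 with rfl | hw0
    · simp
    · rw [Function.update_of_ne hw0, hw]
      field_simp
  · have h1 : DifferentiableAt ℂ (fun w => f w / w ^ m) z :=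
      (hf z hz).differentiableAt.div (by fun_prop) (pow_ne_zero _ hz0)
    refine h1.congr_of_eventuallyEq ?_
    filter_upwards [isOpen_ne.mem_nhds hz0] with w hw
    rw [Function.update_of_ne hw]

/-! ### The maximum modulus -/

lemma maxModulus_nonneg (r : ℝ) (g : ℂ → ℂ) : 0 ≤ maxModulus r g := by
  refine Real.sSup_nonneg ?_
  rintro _ ⟨z, -, rfl⟩
  exact norm_nonneg _

lemma maxModulus_le {r B : ℝ} {g : ℂ → ℂ} (hB : 0 ≤ B)
    (h : ∀ z ∈ sphere (0 : ℂ) r, ‖g z‖ ≤ B) : maxModulus r g ≤ B := by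
  refine Real.sSup_le ?_ hB
  rintro _ ⟨z, hz, rfl⟩
  exact h z hz

lemma norm_le_maxModulus {r : ℝ} {g : ℂ → ℂ} (hg : AnalyticOnNhd ℂ g unitDisc) (hr : r < 1)
    {z : ℂ} (hz : z ∈ sphere (0 : ℂ) r) : ‖g z‖ ≤ maxModulus r g := by
  refine le_csSup ?_ ⟨z, hz, rfl⟩
  exact (((isCompact_sphere (0 : ℂ) r).image_of_continuousOn
    (hg.continuousOn.mono
      (sphere_subset_closedBall.trans (closedBall_subset_ball hr))).norm)).bddAbove

/-- The maximum principle. -/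
lemma norm_le_of_forall_sphere {t B : ℝ} {g : ℂ → ℂ} (hg : AnalyticOnNhd ℂ g unitDisc)
    (ht0 : 0 < t) (ht : t < 1) (hB : ∀ z ∈ sphere (0 : ℂ) t, ‖g z‖ ≤ B) {z : ℂ} (hz : ‖z‖ ≤ t) :
    ‖g z‖ ≤ B := by
  refine Complex.norm_le_of_forall_mem_frontier_norm_le (U := ball 0 t) isBounded_ball
    (DifferentiableOn.diffContOnCl (hg.differentiableOn.mono
      (closure_ball_subset_closedBall.trans (closedBall_subset_ball ht)))) ?_ ?_
  · rwa [frontier_ball _ ht0.ne']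
  · rw [closure_ball _ ht0.ne']; simpa using hz

/-! ### Growth of solutions -/

/-- Grönwall's inequality along rays, for the vector of the first `k` derivatives. -/
lemma posLog_maxModulus_solution_le {k : ℕ} (hk : 1 ≤ k) {A : ℕ → ℂ → ℂ}
    (hA : ∀ j < k, AnalyticOnNhd ℂ (A j) unitDisc) {f : ℂ → ℂ} (hf : IsSolution k A f) :
    ∃ C : ℝ, 0 ≤ C ∧ ∀ r, 0 < r → r < 1 → ∀ S, (∀ j < k, maxModulus r (A j) ≤ S) →
      Real.posLog (maxModulus r f) ≤ C + k * S := by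
  obtain ⟨hfa, hode⟩ := hf
  have hder : ∀ n, AnalyticOnNhd ℂ (iteratedDeriv n f) unitDisc := fun n => by
    rw [iteratedDeriv_eq_iterate]; exact hfa.iterated_deriv n
  let Y : ℂ → ℝ → Fin k → ℂ := fun z t j => iteratedDeriv j f ((t : ℂ) * z)
  have hY0 : ∀ z, Y z 0 = fun j : Fin k => iteratedDeriv j f 0 := fun z => by simp [Y]
  set D : ℝ := ‖fun j : Fin k => iteratedDeriv j f 0‖ with hD
  have hD0 : 0 ≤ D := norm_nonneg _
  refine ⟨Real.posLog D + 1, by linarith [Real.posLog_nonneg (x := D)], fun r hr0 hr S hS => ?_⟩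
  have hS0 : 0 ≤ S := (maxModulus_nonneg _ _).trans (hS 0 (by omega))
  have hbound : ∀ z ∈ sphere (0 : ℂ) r, ‖f z‖ ≤ D * Real.exp (1 + k * S) := by
    intro z hz
    have hzr : ‖z‖ = r := by simpa using hz
    have hmem : ∀ t ∈ Icc (0 : ℝ) 1, ‖(t : ℂ) * z‖ ≤ r := by
      intro t ht
      rw [norm_mul, Complex.norm_real, Real.norm_of_nonneg ht.1, hzr]
      nlinarith [ht.2]
    have hmem' : ∀ t ∈ Icc (0 : ℝ) 1, (t : ℂ) * z ∈ unitDisc := fun t ht => by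
      have := hmem t ht
      simp only [unitDisc, mem_ball_zero_iff]; linarith
    have hYd : ∀ t ∈ Icc (0 : ℝ) 1, HasDerivAt (Y z)
        (fun j : Fin k => iteratedDeriv (j + 1) f ((t : ℂ) * z) * z) t := by
      intro t ht
      refine hasDerivAt_pi.2 fun j => ?_
      have h1 : HasDerivAt (iteratedDeriv j f) (iteratedDeriv (j + 1) f ((t : ℂ) * z))
          ((t : ℂ) * z) := by
        rw [iteratedDeriv_succ]
        exact (hder j _ (hmem' t ht)).differentiableAt.hasDerivAt
      have h2 : HasDerivAt (fun t : ℝ => (t : ℂ) * z) z t := by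
        simpa using (Complex.ofRealCLM.hasDerivAt (x := t)).mul_const z
      exact h1.comp t h2
    have hYb : ∀ t ∈ Icc (0 : ℝ) 1,
        ‖fun j : Fin k => iteratedDeriv (j + 1) f ((t : ℂ) * z) * z‖ ≤ (1 + k * S) * ‖Y z t‖ := by
      intro t ht
      refine (pi_norm_le_iff_of_nonneg (by positivity)).2 fun j => ?_
      have hcomp : ∀ i, i < k → ‖iteratedDeriv i f ((t : ℂ) * z)‖ ≤ ‖Y z t‖ := fun i hi =>
        norm_le_pi_norm (Y z t) ⟨i, hi⟩
      have hz1 : ‖iteratedDeriv (j + 1) f ((t : ℂ) * z) * z‖ ≤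
          ‖iteratedDeriv (j + 1) f ((t : ℂ) * z)‖ := by
        rw [norm_mul]
        exact mul_le_of_le_one_right (norm_nonneg _) (by linarith)
      refine hz1.trans ?_
      have hYn := norm_nonneg (Y z t)
      have hkS : 0 ≤ k * S * ‖Y z t‖ := by positivity
      rcases Nat.lt_or_ge (j + 1) k with hj | hj
      · have := hcomp _ hj
        linarith
      · have hjk : (j : ℕ) + 1 = k := by omega
        rw [hjk, eq_neg_of_add_eq_zero_left (hode _ (hmem' t ht)), norm_neg]
        have h3 : ‖∑ j ∈ Finset.range k, A j ((t : ℂ) * z) * iteratedDeriv j f ((t : ℂ) * z)‖ ≤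
            ∑ j ∈ Finset.range k, S * ‖Y z t‖ := by
          refine norm_sum_le_of_le _ fun i hi => ?_
          rw [Finset.mem_range] at hi
          rw [norm_mul]
          refine mul_le_mul ?_ (hcomp i hi) (norm_nonneg _) hS0
          exact norm_le_of_forall_sphere (hA i hi) hr0 hr
            (fun w hw => (norm_le_maxModulus (hA i hi) hr hw).trans (hS i hi)) (hmem t ht)
        rw [Finset.sum_const, Finset.card_range, nsmul_eq_mul] at h3
        linarith
    have hg := norm_le_gronwallBound_of_norm_deriv_right_le (f := Y z) (δ := D)
      (K := 1 + k * S) (ε := 0) (a := 0) (b := 1)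
      (fun t ht => (hYd t ht).continuousAt.continuousWithinAt)
      (fun t ht => (hYd t (Ico_subset_Icc_self ht)).hasDerivWithinAt)
      (by rw [hY0]) (fun t ht => by simpa using hYb t (Ico_subset_Icc_self ht)) 1 (by simp)
    rw [gronwallBound_ε0] at hg
    have h0 : ‖f z‖ ≤ ‖Y z 1‖ := by
      simpa [Y] using norm_le_pi_norm (Y z 1) ⟨0, by omega⟩
    simpa using h0.trans hg
  have hM := maxModulus_le (by positivity) hbound
  calc Real.posLog (maxModulus r f) ≤ Real.posLog (D * Real.exp (1 + k * S)) :=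
        Real.posLog_le_posLog (maxModulus_nonneg _ _) hM
    _ ≤ Real.posLog D + Real.posLog (Real.exp (1 + k * S)) := Real.posLog_mul
    _ = Real.posLog D + 1 + k * S := by
        rw [Real.posLog_apply, Real.posLog_apply, Real.log_exp, max_eq_right (b := 1 + k * S)
          (by positivity)]
        ring

/-- The converse estimate. On a circle where the solution varies slowly, Cauchy's estimates bound
the quotients `f⁽ʲ⁾ / f`, hence the coefficient `A 0`; the maximum principle carries the bound
over to `|z| = r`. -/
lemma posLog_maxModulus_coeff_zero_le {k : ℕ} (hk : 1 ≤ k) {A : ℕ → ℂ → ℂ}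
    (hA : ∀ j < k, AnalyticOnNhd ℂ (A j) unitDisc) {f : ℂ → ℂ} (hf : IsSolution k A f)
    (hf0 : ∃ z ∈ unitDisc, f z ≠ 0) :
    ∃ C : ℝ, 0 ≤ C ∧ ∀ r, 1 / 2 < r → r < 1 → ∀ S, 0 ≤ S →
      (∀ j, 1 ≤ j → j < k → maxModulus ((r + 3) / 4) (A j) ≤ S) →
      Real.posLog (maxModulus r (A 0)) ≤ C * (1 + Real.posLog S +
        Real.posLog (Real.posLog (maxModulus ((r + 3) / 4) f)) + Real.posLog (1 / (1 - r))) := by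
  obtain ⟨hfa, hode⟩ := hf
  obtain ⟨m, F, hF, hF0, hfF⟩ := exists_eq_pow_mul hfa hf0
  -- `c₀ + log⁺ M(r', f)` bounds `log M(r', F) - log ‖F 0‖`, where `f = z ^ m * F`
  set c₀ : ℝ := 1 + Real.posLog (2 ^ m) + |Real.log ‖F 0‖| with hc₀
  have hp2 := Real.posLog_nonneg (x := 2 ^ m)
  have hlF := abs_nonneg (Real.log ‖F 0‖)
  set K : ℝ := 2 ^ m * Real.exp 2 with hK
  have hK0 : 0 < K := by positivity
  set Q : ℝ := k * (k.factorial * K) with hQ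
  have hQ0 : 0 ≤ Q := by positivity
  set C₁ : ℝ := Real.posLog 32 + 2 * (Real.log 2 + Real.posLog c₀) + 4 * Real.posLog 4 with hC₁
  have hC₁0 : 0 ≤ C₁ := by
    have := Real.posLog_nonneg (x := 32)
    have := Real.posLog_nonneg (x := c₀)
    have := Real.posLog_nonneg (x := 4)
    have := Real.log_nonneg (show (1 : ℝ) ≤ 2 by norm_num)
    positivity
  have hl2 := Real.log_nonneg (show (1 : ℝ) ≤ 2 by norm_num)
  have hpQ := Real.posLog_nonneg (x := Q)
  refine ⟨Real.posLog Q + Real.log 2 + k * C₁ + 4 * k + 1, by positivity, ?_⟩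
  intro r hr2 hr1 S hS0 hS
  set d : ℝ := (1 - r) / 4 with hd
  have hd0 : 0 < d := by linarith
  have hr' : (r + 3) / 4 = r + 3 * d := by rw [hd]; ring
  rw [hr'] at hS ⊢
  set r' := r + 3 * d with hr'def
  have hr'1 : r' < 1 := by linarith
  set Mf := maxModulus r' f with hMf
  have hMf0 : 0 ≤ Mf := maxModulus_nonneg _ _
  have hMF : ∀ z ∈ sphere (0 : ℂ) r', ‖F z‖ ≤ 2 ^ m * Mf := by
    intro z hz
    have hzr : ‖z‖ = r' := by simpa using hz
    have h1 := norm_le_maxModulus hfa hr'1 hz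
    rw [hfF z, norm_mul, norm_pow] at h1
    have h2 : 1 ≤ 2 ^ m * ‖z‖ ^ m := by
      rw [← mul_pow]; exact one_le_pow₀ (by linarith)
    calc ‖F z‖ ≤ (2 ^ m * ‖z‖ ^ m) * ‖F z‖ := le_mul_of_one_le_left (norm_nonneg _) h2
      _ = 2 ^ m * (‖z‖ ^ m * ‖F z‖) := by ring
      _ ≤ 2 ^ m * Mf := by gcongr
  set L : ℝ := c₀ + Real.posLog Mf with hL
  have hpM := Real.posLog_nonneg (x := Mf)
  have hL1 : 1 ≤ L := by linarith
  have hLlog : Real.log (2 ^ m * Mf) - Real.log ‖F 0‖ ≤ L := by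
    have h1 : Real.log (2 ^ m * Mf) ≤ Real.posLog (2 ^ m * Mf) := le_max_right _ _
    have h2 := Real.posLog_mul (x := 2 ^ m) (y := Mf)
    have h3 := neg_abs_le (Real.log ‖F 0‖)
    linarith
  obtain ⟨t, hrt, htd, ht⟩ := exists_circle_slow_variation hF hF0 (by linarith) hd0
    (by linarith) hMF hL1 hLlog
  set s : ℝ := d ^ 4 / (32 * L ^ 2) with hs
  have hs0 : 0 < s := by positivity
  have hsd : s ≤ d := by
    rw [hs, div_le_iff₀ (by positivity)]
    have h1 : d ^ 4 ≤ d * 1 := by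
      rw [pow_succ']; gcongr; exact pow_le_one₀ hd0.le (by linarith)
    have h2 : 1 ≤ L ^ 2 := one_le_pow₀ hL1
    nlinarith
  have hs1 : s ≤ 1 := by linarith
  have hA0 : ∀ z ∈ sphere (0 : ℂ) t, ‖A 0 z‖ ≤ Q * (1 / s) ^ k * (1 + S) := by
    intro z hz
    have hzt : ‖z‖ = t := by simpa using hz
    obtain ⟨hFz, hFw⟩ := ht z hz
    have hz0 : z ≠ 0 := norm_pos_iff.1 (by linarith)
    have hfz : 0 < ‖f z‖ := by
      rw [hfF z]; exact norm_pos_iff.2 (mul_ne_zero (pow_ne_zero _ hz0) hFz)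
    have hz1 : z ∈ unitDisc := by simp only [unitDisc, mem_ball_zero_iff]; linarith
    have hsub : closedBall z s ⊆ unitDisc :=
      (closedBall_subset_ball' (by rw [dist_zero_right, hzt]; linarith))
    have hfw : ∀ w ∈ sphere z s, ‖f w‖ ≤ K * ‖f z‖ := by
      intro w hw
      have hws : ‖w - z‖ = s := by rw [← dist_eq_norm]; exact hw
      have hw2 : ‖w‖ ≤ 2 * ‖z‖ := by
        have := norm_add_le (w - z) z
        rw [sub_add_cancel] at this
        linarith
      rw [hfF w, hfF z]
      simp only [norm_mul, norm_pow]
      calc ‖w‖ ^ m * ‖F w‖ ≤ (2 * ‖z‖) ^ m * (Real.exp 2 * ‖F z‖) := by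
            gcongr; exact hFw w hws.le
        _ = K * (‖z‖ ^ m * ‖F z‖) := by rw [hK, mul_pow]; ring
    have hder : ∀ j ≤ k, ‖iteratedDeriv j f z‖ ≤ k.factorial * K * (1 / s) ^ k * ‖f z‖ := by
      intro j hj
      have h1 := Complex.norm_iteratedDeriv_le_of_forall_mem_sphere_norm_le j hs0
        (DifferentiableOn.diffContOnCl
          (hfa.differentiableOn.mono (closure_ball_subset_closedBall.trans hsub))) hfw
      have h2 : (1 / s) ^ j ≤ (1 / s) ^ k :=
        pow_le_pow_right₀ ((one_le_div hs0).2 hs1) hj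
      have h3 : (j.factorial : ℝ) ≤ k.factorial := by exact_mod_cast Nat.factorial_le hj
      calc ‖iteratedDeriv j f z‖ ≤ j.factorial * (K * ‖f z‖) / s ^ j := h1
        _ = j.factorial * K * (1 / s) ^ j * ‖f z‖ := by rw [one_div, inv_pow]; ring
        _ ≤ _ := by gcongr
    obtain ⟨n, rfl⟩ : ∃ n, k = n + 1 := ⟨k - 1, by omega⟩
    set q : ℝ := (n + 1).factorial * K * (1 / s) ^ (n + 1) with hq
    have hq0 : 0 ≤ q := by positivity
    have hode' := hode z hz1
    rw [Finset.sum_range_succ', ← add_assoc, iteratedDeriv_zero] at hode'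
    have h4 : ‖A 0 z‖ * ‖f z‖ ≤ (Q * (1 / s) ^ (n + 1) * (1 + S)) * ‖f z‖ := by
      rw [← norm_mul, eq_neg_of_add_eq_zero_right hode', norm_neg]
      have h5 : ‖∑ j ∈ Finset.range n, A (j + 1) z * iteratedDeriv (j + 1) f z‖ ≤
          ∑ j ∈ Finset.range n, S * (q * ‖f z‖) := by
        refine norm_sum_le_of_le _ fun j hj => ?_
        rw [Finset.mem_range] at hj
        rw [norm_mul]
        refine mul_le_mul ?_ (hder _ (by omega)) (norm_nonneg _) hS0
        exact norm_le_of_forall_sphere (hA _ (by omega)) (by linarith) hr'1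
          (fun w hw => (norm_le_maxModulus (hA _ (by omega)) hr'1 hw).trans
            (hS _ (by omega) (by omega))) (by linarith)
      rw [Finset.sum_const, Finset.card_range, nsmul_eq_mul] at h5
      refine (norm_add_le _ _).trans ((add_le_add (hder _ le_rfl) h5).trans ?_)
      have h6 : (Q * (1 / s) ^ (n + 1) * (1 + S)) * ‖f z‖ =
          q * ‖f z‖ + n * (S * (q * ‖f z‖)) + (n * (q * ‖f z‖) + S * (q * ‖f z‖)) := by
        rw [hQ, hq]; push_cast; ring
      rw [h6]
      exact le_add_of_nonneg_right (by positivity)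
    exact le_of_mul_le_mul_right h4 hfz
  have hMA : maxModulus r (A 0) ≤ Q * (1 / s) ^ k * (1 + S) :=
    maxModulus_le (by positivity) fun z hz =>
      norm_le_of_forall_sphere (hA 0 (by omega)) (by linarith) (by linarith) hA0
        (by have : ‖z‖ = r := by simpa using hz
            linarith)
  have hlogs : Real.posLog (1 / s) ≤ C₁ + 2 * Real.posLog (Real.posLog Mf) +
      4 * Real.posLog (1 / (1 - r)) := by
    have h1 : 1 / s = 32 * L ^ 2 * (4 * (1 / (1 - r))) ^ 4 := by
      have : 1 - r ≠ 0 := by linarith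
      rw [hs, hd]; field_simp
    have h2 := Real.posLog_mul (x := 32 * L ^ 2) (y := (4 * (1 / (1 - r))) ^ 4)
    have h3 := Real.posLog_mul (x := 32) (y := L ^ 2)
    have h4 := Real.posLog_mul (x := 4) (y := 1 / (1 - r))
    have h5 := Real.posLog_add (x := c₀) (y := Real.posLog Mf)
    rw [Real.posLog_pow] at h2 h3
    rw [h1]
    push_cast at h2 h3
    linarith
  have hpL := Real.posLog_nonneg (x := Real.posLog Mf)
  have hpr := Real.posLog_nonneg (x := 1 / (1 - r))
  have hpS := Real.posLog_nonneg (x := S)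
  have h1 := Real.posLog_mul (x := Q * (1 / s) ^ k) (y := 1 + S)
  have h2 := Real.posLog_mul (x := Q) (y := (1 / s) ^ k)
  have h3 := Real.posLog_add (x := 1) (y := S)
  rw [Real.posLog_pow] at h2
  rw [Real.posLog_one] at h3
  have h4 := Real.posLog_le_posLog (maxModulus_nonneg _ _) hMA
  have h5 : (k : ℝ) * Real.posLog (1 / s) ≤ k * (C₁ + 2 * Real.posLog (Real.posLog Mf) +
      4 * Real.posLog (1 / (1 - r))) := by gcongr
  have hk0 : (0 : ℝ) ≤ k := by positivity
  have hkC : 0 ≤ k * C₁ := by positivity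
  set X := Real.posLog (Real.posLog Mf)
  set W := Real.posLog (1 / (1 - r))
  set V := Real.posLog S
  have h6 : 0 ≤ (Real.posLog Q + Real.log 2 + k * C₁) * (V + X + W) := by positivity
  have h7 : 0 ≤ (4 * k) * V + 2 * k * X + 4 * k + 1 + X + W := by positivity
  linarith

/-! ### The scale functions -/

lemma ClassL.monotone {α : ℝ → ℝ} (h : ClassL α) : Monotone α := by
  obtain ⟨x₀, h1, h2⟩ := h.increasing
  intro x y hxy
  rcases le_total y x₀ with hy | hy
  · rw [h1 x (hxy.trans hy), h1 y hy]
  · rcases le_total x x₀ with hx | hx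
    · rw [h1 x hx]
      exact h2 (mem_Ici.2 le_rfl) (mem_Ici.2 hy) hy
    · exact h2 (mem_Ici.2 hx) (mem_Ici.2 hy) hxy

lemma ClassL1.exists_add_le {α : ℝ → ℝ} (h : ClassL1 α) (b : ℝ) :
    ∃ C, ∀ a, α (a + b) ≤ α a + C := by
  obtain ⟨R₀, c, -, hc⟩ := h.quasi_subadd
  refine ⟨α R₀ + α (max b R₀) + c, fun a => ?_⟩
  have h1 : α (a + b) ≤ α (max a R₀ + max b R₀) :=
    h.toClassL.monotone (add_le_add (le_max_left _ _) (le_max_left _ _))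
  have h2 := hc (max a R₀) (max b R₀) (le_max_right _ _) (le_max_right _ _)
  have h3 : α (max a R₀) ≤ α a + α R₀ := by
    rcases max_choice a R₀ with h' | h' <;> rw [h']
    · linarith [h.nonneg R₀]
    · linarith [h.nonneg a]
  linarith

lemma tendsto_one_div_one_sub : Tendsto (fun r : ℝ => 1 / (1 - r)) (𝓝[<] 1) atTop := by
  simp only [one_div]
  refine tendsto_inv_nhdsGT_zero.comp (tendsto_nhdsWithin_iff.2 ⟨?_, ?_⟩)
  · have : Tendsto (fun r : ℝ => 1 - r) (𝓝 1) (𝓝 (1 - 1)) := by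
      exact (continuous_const.sub continuous_id).tendsto 1
    rw [sub_self] at this
    exact this.mono_left nhdsWithin_le_nhds
  · filter_upwards [self_mem_nhdsWithin] with r hr
    simpa using hr

lemma tendsto_add_three_div_four : Tendsto (fun r : ℝ => (r + 3) / 4) (𝓝[<] 1) (𝓝[<] 1) := by
  refine tendsto_nhdsWithin_iff.2 ⟨?_, ?_⟩
  · have : Tendsto (fun r : ℝ => (r + 3) / 4) (𝓝 1) (𝓝 ((1 + 3) / 4)) :=
      Continuous.tendsto (by fun_prop) 1
    norm_num at this
    exact this.mono_left nhdsWithin_le_nhds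
  · filter_upwards [self_mem_nhdsWithin] with r hr
    rw [mem_Iio] at hr ⊢
    linarith

lemma ClassL2.tendsto_log_comp {β γ : ℝ → ℝ} (hβ : ClassL2 β) (hγ : ClassL3 γ) :
    Tendsto (fun x => β (Real.log (γ x))) atTop atTop :=
  hβ.tendsto.comp (Real.tendsto_log_atTop.comp hγ.tendsto)

/-- Since `γ (4 x) ≤ 4 γ x`, passing from `x` to `4 x` shifts `log (γ x)` by a bounded amount
only. -/
lemma ClassL2.eventually_comp_four_mul_le {β γ : ℝ → ℝ} (hβ : ClassL2 β) (hγ : ClassL3 γ)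
    {ε : ℝ} (hε : 0 < ε) :
    ∀ᶠ x in atTop, β (Real.log (γ (4 * x))) ≤ (1 + ε) * β (Real.log (γ x)) := by
  obtain ⟨R₀, hR₀⟩ := hγ.subadd
  have hshift :=
    (hβ.shift (fun _ => Real.log 4) (isBigO_const_const _ one_ne_zero _)).isLittleO.def hε
  have hlog : Tendsto (fun x => Real.log (γ x)) atTop atTop :=
    Real.tendsto_log_atTop.comp hγ.tendsto
  filter_upwards [hlog.eventually hshift, hγ.tendsto.eventually_gt_atTop 0,
    eventually_ge_atTop R₀, eventually_ge_atTop 0] with x h1 h2 h3 h4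
  have h5 : γ (4 * x) ≤ 4 * γ x := by
    have h6 := hR₀ x x h3 h3
    have h7 := hR₀ (x + x) (x + x) (by linarith) (by linarith)
    rw [show 4 * x = x + x + (x + x) by ring]
    linarith
  have h6 : γ x ≤ γ (4 * x) := hγ.toClassL.monotone (by linarith)
  have h7 : Real.log (γ (4 * x)) ≤ Real.log (γ x) + Real.log 4 := by
    rw [← Real.log_mul h2.ne' (by norm_num), mul_comm (γ x)]
    exact Real.log_le_log (by linarith) h5
  have h8 := hβ.toClassL.monotone h7
  simp only [Pi.sub_apply, Real.norm_eq_abs, abs_of_nonneg (hβ.nonneg _)] at h1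
  have h9 := (le_abs_self _).trans h1
  linarith

/-- The case `p = 2` of the condition on iterated logarithms: errors of size `log (1 / (1 - r))` in
`log M(r, A 0)` do not affect the order. -/
lemma Admissible.eventually_posLog_le {α β γ : ℝ → ℝ} (h : Admissible α β γ) {ε : ℝ}
    (hε : 0 < ε) :
    ∀ᶠ x in atTop, α (Real.posLog (Real.posLog x)) ≤ ε * β (Real.log (γ x)) := by
  filter_upwards [(h.iter_log 2 le_rfl).def hε, eventually_ge_atTop 1,
    Real.tendsto_log_atTop.eventually_ge_atTop 1] with x h1 h2 h3
  rw [Real.norm_of_nonneg (h.mem_L1.nonneg _), Real.norm_of_nonneg (h.mem_L2.nonneg _)] at h1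
  rw [Real.posLog_eq_log (x := x) (h2.trans (le_abs_self x)),
    Real.posLog_eq_log (h3.trans (le_abs_self _))]
  exact h1

/-! ### Growth orders -/

lemma Admissible.tendsto_denominator {α β γ : ℝ → ℝ} (h : Admissible α β γ) :
    Tendsto (fun r : ℝ => β (Real.log (γ (1 / (1 - r))))) (𝓝[<] 1) atTop :=
  (h.mem_L2.tendsto_log_comp h.mem_L3).comp tendsto_one_div_one_sub

lemma Admissible.eventually_of_growthOrder_lt {α β γ : ℝ → ℝ} (h : Admissible α β γ) {p : ℕ}
    {g : ℂ → ℂ} {q : ℝ} (hq : growthOrder p α β γ g < q) :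
    ∀ᶠ r in 𝓝[<] (1 : ℝ), α (Real.posLog^[p] (maxModulus r g)) ≤
      q * β (Real.log (γ (1 / (1 - r)))) := by
  filter_upwards [eventually_lt_of_limsup_lt hq, h.tendsto_denominator.eventually_gt_atTop 0]
    with r h1 h2
  exact ((div_lt_iff₀ h2).1 (EReal.coe_lt_coe_iff.1 h1)).le

lemma Admissible.growthOrder_le {α β γ : ℝ → ℝ} (h : Admissible α β γ) {p : ℕ}
    {g : ℂ → ℂ} {q : ℝ} (hq : ∀ᶠ r in 𝓝[<] (1 : ℝ), α (Real.posLog^[p] (maxModulus r g)) ≤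
      q * β (Real.log (γ (1 / (1 - r))))) : growthOrder p α β γ g ≤ q := by
  refine limsup_le_of_le (by isBoundedDefault) ?_
  filter_upwards [hq, h.tendsto_denominator.eventually_gt_atTop 0] with r h1 h2
  exact EReal.coe_le_coe_iff.2 ((div_le_iff₀ h2).2 h1)

/-- A common bound for the coefficients, on the scale of `growthOrder 2`, is passed on to the
solution, on the scale of `growthOrder 3`. -/
lemma Admissible.eventually_solution_le {α β γ : ℝ → ℝ} (h : Admissible α β γ) {k : ℕ}
    (hk : 1 ≤ k) {A : ℕ → ℂ → ℂ} (hA : ∀ j < k, AnalyticOnNhd ℂ (A j) unitDisc) {f : ℂ → ℂ}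
    (hf : IsSolution k A f) {q ε : ℝ} (hε : 0 < ε)
    (hq : ∀ j < k, ∀ᶠ r in 𝓝[<] (1 : ℝ), α (Real.posLog^[2] (maxModulus r (A j))) ≤
      q * β (Real.log (γ (1 / (1 - r))))) :
    ∀ᶠ r in 𝓝[<] (1 : ℝ), α (Real.posLog^[3] (maxModulus r f)) ≤
      (q + ε) * β (Real.log (γ (1 / (1 - r)))) := by
  obtain ⟨C, hC0, hC⟩ := posLog_maxModulus_solution_le hk hA hf
  set c₁ : ℝ := Real.log 2 + Real.posLog C + Real.log k with hc₁
  obtain ⟨D, hD⟩ := h.mem_L1.exists_add_le (Real.log 2 + Real.posLog c₁)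
  have hq' : ∀ᶠ r in 𝓝[<] (1 : ℝ), ∀ j ∈ Finset.range k,
      α (Real.posLog^[2] (maxModulus r (A j))) ≤ q * β (Real.log (γ (1 / (1 - r)))) :=
    (eventually_all_finset _).2 fun j hj => hq j (Finset.mem_range.1 hj)
  filter_upwards [hq', h.tendsto_denominator.eventually_ge_atTop (D / ε),
    Ioo_mem_nhdsLT (show (0 : ℝ) < 1 by norm_num)] with r h1 h2 h3
  obtain ⟨i, hi, himax⟩ := Finset.exists_max_image (Finset.range k)
    (fun j => maxModulus r (A j)) ⟨0, by simp; omega⟩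
  set S := maxModulus r (A i) with hS
  have hM := hC r h3.1 h3.2 S (fun j hj => himax j (Finset.mem_range.2 hj))
  have h4 : Real.posLog (Real.posLog (maxModulus r f)) ≤ Real.posLog S + c₁ := by
    have h5 := Real.posLog_le_posLog Real.posLog_nonneg hM
    have h6 := Real.posLog_add (x := C) (y := k * S)
    have h7 := Real.posLog_nat_mul (n := k) (x := S)
    linarith
  have h5 : Real.posLog (Real.posLog (Real.posLog (maxModulus r f))) ≤
      Real.posLog (Real.posLog S) + (Real.log 2 + Real.posLog c₁) := by
    have h6 := Real.posLog_le_posLog Real.posLog_nonneg h4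
    have h7 := Real.posLog_add (x := Real.posLog S) (y := c₁)
    linarith
  have h6 : α (Real.posLog (Real.posLog S)) ≤ q * β (Real.log (γ (1 / (1 - r)))) := h1 i hi
  rw [div_le_iff₀ hε] at h2
  calc α (Real.posLog (Real.posLog (Real.posLog (maxModulus r f))))
      ≤ α (Real.posLog (Real.posLog S) + (Real.log 2 + Real.posLog c₁)) :=
        h.mem_L1.toClassL.monotone h5
    _ ≤ α (Real.posLog (Real.posLog S)) + D := hD _
    _ ≤ _ := by linarith

/-- A common bound for the solution and for the coefficients other than `A 0` is passed on to
`A 0`. The estimates are taken on the larger circle of radius `(r + 3) / 4`. -/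
lemma Admissible.eventually_coeff_zero_le {α β γ : ℝ → ℝ} (h : Admissible α β γ) {k : ℕ}
    (hk : 2 ≤ k) {A : ℕ → ℂ → ℂ} (hA : ∀ j < k, AnalyticOnNhd ℂ (A j) unitDisc) {f : ℂ → ℂ}
    (hf : IsSolution k A f) (hf0 : ∃ z ∈ unitDisc, f z ≠ 0) {q ε : ℝ} (hε : 0 < ε)
    (hq : ∀ j ∈ Finset.Ico 1 k, ∀ᶠ r in 𝓝[<] (1 : ℝ),
      α (Real.posLog^[2] (maxModulus r (A j))) ≤ q * β (Real.log (γ (1 / (1 - r)))))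
    (hqf : ∀ᶠ r in 𝓝[<] (1 : ℝ), α (Real.posLog^[3] (maxModulus r f)) ≤
      q * β (Real.log (γ (1 / (1 - r))))) :
    ∀ᶠ r in 𝓝[<] (1 : ℝ), α (Real.posLog^[2] (maxModulus r (A 0))) ≤
      (q + ε) * β (Real.log (γ (1 / (1 - r)))) := by
  have hq0 : 0 ≤ q := by
    obtain ⟨r, h1, h2⟩ := (hqf.and (h.tendsto_denominator.eventually_gt_atTop 0)).exists
    exact nonneg_of_mul_nonneg_left ((h.mem_L1.nonneg _).trans h1) h2
  obtain ⟨C, hC0, hC⟩ := posLog_maxModulus_coeff_zero_le (by omega) hA hf hf0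
  set c₁ : ℝ := Real.posLog C + Real.log 2 + Real.posLog 3 with hc₁
  obtain ⟨D, hD⟩ := h.mem_L1.exists_add_le c₁
  -- chosen so that `q * (1 + δ) + 2 * δ = q + ε`
  set δ : ℝ := ε / (q + 2) with hδ
  have hδ0 : 0 < δ := by positivity
  have hδε : q * (1 + δ) + 2 * δ = q + ε := by rw [hδ]; field_simp; ring
  have hq' := tendsto_add_three_div_four.eventually ((eventually_all_finset _).2 hq)
  have hqf' := tendsto_add_three_div_four.eventually hqf
  filter_upwards [hq', hqf', h.tendsto_denominator.eventually_ge_atTop (D / δ),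
    tendsto_one_div_one_sub.eventually (h.mem_L2.eventually_comp_four_mul_le h.mem_L3 hδ0),
    tendsto_one_div_one_sub.eventually (h.eventually_posLog_le hδ0),
    Ioo_mem_nhdsLT (show (1 / 2 : ℝ) < 1 by norm_num)] with r h1 h2 h3 h4 h5 h6
  have hr1 : 1 - r ≠ 0 := by linarith [h6.2]
  rw [show 1 / (1 - (r + 3) / 4) = 4 * (1 / (1 - r)) by
    have : (1 : ℝ) - (r + 3) / 4 = (1 - r) / 4 := by ring
    rw [this]; field_simp] at h1 h2
  set B := β (Real.log (γ (1 / (1 - r)))) with hB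
  have hB0 : 0 ≤ B := h.mem_L2.nonneg _
  obtain ⟨i, hi, himax⟩ := Finset.exists_max_image (Finset.Ico 1 k)
    (fun j => maxModulus ((r + 3) / 4) (A j)) ⟨1, by simp; omega⟩
  set S := maxModulus ((r + 3) / 4) (A i) with hS
  have hM := hC r h6.1 h6.2 S (maxModulus_nonneg _ _)
    (fun j hj1 hj2 => himax j (Finset.mem_Ico.2 ⟨hj1, hj2⟩))
  set V := Real.posLog S with hV
  set X := Real.posLog (Real.posLog (maxModulus ((r + 3) / 4) f)) with hX
  set W := Real.posLog (1 / (1 - r)) with hW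
  have hVB : α (Real.posLog V) ≤ q * (1 + δ) * B + δ * B := by
    have h7 : α (Real.posLog V) ≤ q * β (Real.log (γ (4 * (1 / (1 - r))))) := h1 i hi
    have h8 := mul_le_mul_of_nonneg_left h4 hq0
    have h9 : 0 ≤ δ * B := by positivity
    linarith
  have hXB : α (Real.posLog X) ≤ q * (1 + δ) * B + δ * B := by
    have h7 : α (Real.posLog X) ≤ q * β (Real.log (γ (4 * (1 / (1 - r))))) := h2
    have h8 := mul_le_mul_of_nonneg_left h4 hq0
    have h9 : 0 ≤ δ * B := by positivity
    linarith
  have hWB : α (Real.posLog W) ≤ q * (1 + δ) * B + δ * B := by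
    have h9 : 0 ≤ q * (1 + δ) * B := by positivity
    linarith
  obtain ⟨T, hT0, hVT, hXT, hWT, hTB⟩ : ∃ T, 0 ≤ T ∧ V ≤ T ∧ X ≤ T ∧ W ≤ T ∧
      α (Real.posLog T) ≤ q * (1 + δ) * B + δ * B := by
    refine ⟨max V (max X W), Real.posLog_nonneg.trans (le_max_left _ _), le_max_left _ _,
      (le_max_left _ _).trans (le_max_right _ _), (le_max_right _ _).trans (le_max_right _ _), ?_⟩
    rcases max_choice V (max X W) with h' | h' <;> rw [h']
    · exact hVB
    · rcases max_choice X W with h'' | h'' <;> rw [h'']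
      · exact hXB
      · exact hWB
  have h7 : Real.posLog (Real.posLog (maxModulus r (A 0))) ≤ Real.posLog T + c₁ := by
    have h8 : Real.posLog (maxModulus r (A 0)) ≤ C * (1 + 3 * T) :=
      hM.trans (mul_le_mul_of_nonneg_left (by linarith) hC0)
    have h9 := Real.posLog_le_posLog Real.posLog_nonneg h8
    have h10 := Real.posLog_mul (x := C) (y := 1 + 3 * T)
    have h11 := Real.posLog_add (x := 1) (y := 3 * T)
    have h12 := Real.posLog_mul (x := 3) (y := T)
    rw [Real.posLog_one] at h11
    linarith
  rw [div_le_iff₀ hδ0] at h3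
  calc α (Real.posLog (Real.posLog (maxModulus r (A 0)))) ≤ α (Real.posLog T + c₁) :=
        h.mem_L1.toClassL.monotone h7
    _ ≤ α (Real.posLog T) + D := hD _
    _ ≤ q * (1 + δ) * B + δ * B + δ * B := by linarith
    _ = (q + ε) * B := by rw [← hδε]; ring

end UnitDiscGrowth

theorem theorem2p1 (α β γ : ℝ → ℝ) (hαβγ : UnitDiscGrowth.Admissible α β γ)
    (k : ℕ) (hk : 2 ≤ k) (A : ℕ → ℂ → ℂ)
    (hA : ∀ j < k, AnalyticOnNhd ℂ (A j) UnitDiscGrowth.unitDisc)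
    (hdom : ∀ j, 1 ≤ j → j < k →
      UnitDiscGrowth.orderM α β γ (A j) < UnitDiscGrowth.orderM α β γ (A 0))
    (f : ℂ → ℂ) (hf : UnitDiscGrowth.IsSolution k A f)
    (hf0 : ∃ z ∈ UnitDiscGrowth.unitDisc, f z ≠ 0) :
    UnitDiscGrowth.logOrderM α β γ f = UnitDiscGrowth.orderM α β γ (A 0) := by
  apply le_antisymm
  · refine le_of_forall_gt fun c hc => ?_
    obtain ⟨q, hq1, hq2⟩ := EReal.lt_iff_exists_real_btwn.1 hc
    obtain ⟨q', hq1', hq2'⟩ := EReal.lt_iff_exists_real_btwn.1 hq2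
    have hqq' : 0 < q' - q := sub_pos.2 (EReal.coe_lt_coe_iff.1 hq1')
    have h1 := hαβγ.eventually_solution_le (by omega) hA hf hqq' fun j hj =>
      hαβγ.eventually_of_growthOrder_lt (p := 2) (by
        rcases Nat.eq_zero_or_pos j with rfl | hj0
        · exact hq1
        · exact (hdom j hj0 hj).trans hq1)
    rw [add_sub_cancel] at h1
    exact (hαβγ.growthOrder_le h1).trans_lt hq2'
  · by_contra! hlt
    have hmax : max (UnitDiscGrowth.logOrderM α β γ f)
        ((Finset.Ico 1 k).sup fun j => UnitDiscGrowth.orderM α β γ (A j)) <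
        UnitDiscGrowth.orderM α β γ (A 0) := by
      refine max_lt hlt ((Finset.sup_lt_iff (bot_le.trans_lt hlt)).2 fun j hj => ?_)
      rw [Finset.mem_Ico] at hj
      exact hdom j hj.1 hj.2
    obtain ⟨q, hq1, hq2⟩ := EReal.lt_iff_exists_real_btwn.1 hmax
    obtain ⟨q', hq1', hq2'⟩ := EReal.lt_iff_exists_real_btwn.1 hq2
    have hqq' : 0 < q' - q := sub_pos.2 (EReal.coe_lt_coe_iff.1 hq1')
    rw [max_lt_iff] at hq1
    have h1 := hαβγ.eventually_coeff_zero_le hk hA hf hf0 hqq'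
      (fun j hj => hαβγ.eventually_of_growthOrder_lt (p := 2)
        ((Finset.le_sup (f := fun j => UnitDiscGrowth.orderM α β γ (A j)) hj).trans_lt hq1.2))
      (hαβγ.eventually_of_growthOrder_lt (p := 3) hq1.1)
    rw [add_sub_cancel] at h1
    exact absurd (hαβγ.growthOrder_le h1) (not_le.2 hq2')
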